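/- **Theorem 2.1.** Let $\Omega\subset\mathbb{R}^2$ be a bounded open set such that every connected component $\mathcal{C}$ of $\partial\Omega$ is a simple closed curve of class $C^2$ with Lipschitz curvature (e.g. of class $C^3$), parametrized by arc length by an $L_{\mathcal{C}}$-periodic map $\gamma$, $L_{\mathcal{C}}$ being the length of $\mathcal{C}$. Let $N(s)$ be the unit normal at $\gamma(s)$ obtained by rotating $\gamma'(s)$ by $+\pi/2$, let $\gamma$ be oriented so that $N$ points into $\Omega$, and let $\kappa$ be the signed curvature, $\gamma''=\kappa N$. Let $\delta_{\mathcal{C}}>0$ be such that $$\psi(n,s)=\gamma(s)+nN(s)$$ is a diffeomorphism from $(0,\delta_{\mathcal{C}})\times\mathbb{R}/L_{\mathcal{C}}\mathbb{Z}$ onto $\{q\in\Omega : d(q,\mathcal{C})<\delta_{\mathcal{C}}\}$, with $d(\psi(n,s),\mathcal{C})=n$. Let $b:\Omega\to\mathbb{R}$ be locally Lipschitz, let $\mathbf{A}=(A_1,A_2)$ be a $C^1$ vector potential on $\Omega$, $\partial_1A_2-\partial_2A_1=b$, and let $\mathcal{H}(q,p)=\frac12\|p-\mathbf{A}(q)\|^2$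 for $(q,p)\in\Omega\times\mathbb{R}^2$. Near $\mathcal{C}$ put $B(n,s)=-b(\psi(n,s))(1-n\kappa(s))$. Assume that, for every connected component $\mathcal{C}$ of $\partial\Omega$, $$\lim_{n\to0^+}\left|\int_n^{\delta_{\mathcal{C}}}\int_0^{L_{\mathcal{C}}}B(\eta,\xi)\,d\xi\,d\eta\right|=+\infty$$ and that there is $M_{\mathcal{C}}\ge0$ such that, for all $(n,s)\in(0,\delta_{\mathcal{C}})\times\mathbb{R}/L_{\mathcal{C}}\mathbb{Z}$, $$\left|B(n,s)-\frac1{L_{\mathcal{C}}}\int_0^{L_{\mathcal{C}}}B(n,\xi)\,d\xi\right|\le M_{\mathcal{C}}.$$ Then the magnetic Hamiltonian dynamics $\dot q=\partial_p\mathcal{H}(q,p)$, $\dot p=-\partial_q\mathcal{H}(q,p)$ is complete: for every $(q_0,p_0)\in\Omega\times\mathbb{R}^2$ there is exactly one solution $(q,p):\mathbb{R}\to\Omega\times\mathbb{R}^2$ with $(q,p)(0)=(q_0,p_0)$; and no solution reaches $\partial\Omega$ in finite time: if $0<T<\infty$ and $(q,p):[0,T)\to\Omega\times\mathbb{R}^2$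 is a solution, then $q(t)$ does not converge to a point of $\partial\Omega$ as $t\to T^-$. -/

import Mathlib

open Set Filter Topology

noncomputable section

namespace MagneticConfinement

/-- The Euclidean plane. -/
abbrev Plane : Type := EuclideanSpace ℝ (Fin 2)

/-- Rotation by the angle `+π/2`. -/
def rot (v : Plane) : Plane := !₂[-(v 1), v 0]

/-! ### Magnetic Hamiltonian dynamics -/

/-- `A = A₁ dq₁ + A₂ dq₂` is a `C¹` vector potential on `Ω` of the magnetic field
`b dq₁ ∧ dq₂`, that is, `∂₁ A₂ - ∂₂ A₁ = b` on `Ω`. -/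
def IsVectorPotential (Ω : Set Plane) (A : Plane → Plane) (b : Plane → ℝ) : Prop :=
  ContDiffOn ℝ 1 A Ω ∧
    ∀ q ∈ Ω, (fderiv ℝ A q (EuclideanSpace.single 0 1)) 1
      - (fderiv ℝ A q (EuclideanSpace.single 1 1)) 0 = b q

/-- The magnetic Hamiltonian `‖p - A(q)‖² / 2`. -/
def hamiltonian (A : Plane → Plane) (q p : Plane) : ℝ := ‖p - A q‖ ^ 2 / 2

/-- `t ↦ z t = (q t, p t)` solves Hamilton's equations `q' = ∂ₚ H`, `p' = -∂_q H` on the set of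
times `I`, with `q t ∈ Ω` for `t ∈ I`. -/
def IsTrajectoryOn (Ω : Set Plane) (A : Plane → Plane) (I : Set ℝ) (z : ℝ → Plane × Plane) :
    Prop :=
  ∀ t ∈ I, (z t).1 ∈ Ω ∧
    HasDerivWithinAt (fun τ => (z τ).1)
      (gradient (fun p => hamiltonian A (z t).1 p) (z t).2) I t ∧
    HasDerivWithinAt (fun τ => (z τ).2)
      (-gradient (fun q => hamiltonian A q (z t).2) (z t).1) I t

/-! ### Boundary curves and tubular coordinates -/

/-- `C` is a connected component of the boundary of `Ω`. -/
def IsBoundaryComponent (Ω C : Set Plane) : Prop :=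
  ∃ x ∈ frontier Ω, C = connectedComponentIn (frontier Ω) x

/-- `γ`, seen as a map on `ℝ / Lℤ`, is a parametrization by arc length of the simple closed curve
`C`. It is of class `C²` and its second derivative is Lipschitz (equivalently, the curvature is
Lipschitz), which holds in particular for every `C³` curve. -/
structure IsArcLengthParam (C : Set Plane) (γ : ℝ → Plane) (L : ℝ) : Prop where
  length_pos : 0 < L
  periodic : Function.Periodic γ L
  contDiff : ContDiff ℝ 2 γ
  lipschitz : ∃ K, LipschitzWith K (deriv (deriv γ))
  unit_speed : ∀ s, ‖deriv γ s‖ = 1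
  injOn : InjOn γ (Ico 0 L)
  range_eq : range γ = C

/-- The unit normal to the left of `γ`; `IsTubularWidth` makes it point into `Ω`. -/
def normal (γ : ℝ → Plane) (s : ℝ) : Plane := rot (deriv γ s)

/-- The signed curvature, `γ'' = κ N`. -/
def curvature (γ : ℝ → Plane) (s : ℝ) : ℝ := inner ℝ (deriv (deriv γ) s) (normal γ s)

/-- The tubular map `ψ(n, s) = γ(s) + n N(s)`. -/
def tubularMap (γ : ℝ → Plane) (x : ℝ × ℝ) : Plane := γ x.2 + x.1 • normal γ x.2

/-- The points of `Ω` at distance less than `δ` from `C`. -/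
def collar (Ω C : Set Plane) (δ : ℝ) : Set Plane := {q ∈ Ω | Metric.infDist q C < δ}

/-- The tubular map is a diffeomorphism from `(0, δ) × ℝ / Lℤ` onto the `δ`-collar of `C` in `Ω`,
with `n` the distance to `C`: the sets `n < δ'` correspond to the `δ'`-collars. Here `[0, L)`
represents `ℝ / Lℤ`, and `1 - n κ(s)` is the Jacobian determinant of the `C¹` map `ψ`. -/
structure IsTubularWidth (Ω C : Set Plane) (γ : ℝ → Plane) (L δ : ℝ) : Prop where
  pos : 0 < δ
  bijOn : ∀ δ' ∈ Ioc 0 δ, BijOn (tubularMap γ) (Ioo 0 δ' ×ˢ Ico 0 L) (collar Ω C δ')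
  jacobian_ne_zero : ∀ n ∈ Ioo 0 δ, ∀ s, 1 - n * curvature γ s ≠ 0

/-- The magnetic field in tubular coordinates, `B(n, s) = -b(ψ(n, s)) (1 - n κ(s))`. -/
def tubularField (b : Plane → ℝ) (γ : ℝ → Plane) (n s : ℝ) : ℝ :=
  -(b (tubularMap γ (n, s))) * (1 - n * curvature γ s)

end MagneticConfinement

end

/-! In the variables `q` and `v = p - A(q)`, Hamilton's equations become `q' = v`, `v' = -b(q) rot
v`. The force is orthogonal to `v`, so the speed is a constant `c`. Hence `q` is Lipschitz and has a
limit at any finite time `T`. If the limit lies in `Ω`, the motion can be continued past `T`;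
everything rests on excluding a limit on a boundary curve.

Near such a curve write `q = ψ(n, s)`. Let `Φ(n)` be the flux of `B` through `(n, δ) × ℝ / Lℤ`
divided by `L` (`meanFlux`), and let `P = (1 - n κ(s)) ⟨v, γ'(s)⟩` be the tangential momentum. If
`B` did not depend on `s` and `κ` were constant, `Φ(n) - P` would be conserved. In general,
formally, its time derivative is `(B - mean of B) n' - κ ⟨v, γ'⟩ n' + (n κ)' ⟨v, γ'⟩`, which is
bounded by the oscillation hypothesis, the constant speed and the Lipschitz curvature. So `Φ(n) - P`
stays bounded up to time `T`; so does `P`, hence also `Φ(n)`. But `n → 0` forces `|Φ(n)| → ∞`, a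
contradiction.

Since `κ` is only Lipschitz, `P` need not be differentiable in time;
`eventually_abs_flux_sub_momentum_sub_le` therefore gives a local Lipschitz estimate, and
`abs_sub_le_of_eventually_abs_sub_le` globalizes it. `not_tendsto_boundary` draws the contradiction,
and `exists_isIntegralCurveIn_Ici` turns it into existence for all positive times. Negative times
follow by reversing the motion, which replaces `b` by `-b`. -/

namespace MagneticConfinement

/-! ### Autonomous equations with a locally Lipschitz right-hand side on an open set -/

section ODE

variable {E : Type*} [NormedAddCommGroup E] [NormedSpace ℝ E]

/-- `α` is an integral curve of the vector field `f` on the set of times `I`, with values in `U`. -/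
def IsIntegralCurveIn (f : E → E) (U : Set E) (I : Set ℝ) (α : ℝ → E) : Prop :=
  ∀ t ∈ I, α t ∈ U ∧ HasDerivWithinAt α (f (α t)) I t

variable {f : E → E} {U : Set E} {I J : Set ℝ} {α β : ℝ → E}

theorem IsIntegralCurveIn.mono (h : IsIntegralCurveIn f U I α) (hJ : J ⊆ I) :
    IsIntegralCurveIn f U J α :=
  fun t ht => ⟨(h t (hJ ht)).1, (h t (hJ ht)).2.mono hJ⟩

theorem IsIntegralCurveIn.continuousOn (h : IsIntegralCurveIn f U I α) : ContinuousOn α I :=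
  fun t ht => (h t ht).2.continuousWithinAt

/-- The two traces form a compact subset of `U`, on which a locally Lipschitz field has a single
Lipschitz constant; Grönwall uniqueness then applies. -/
theorem IsIntegralCurveIn.eqOn_Icc (hf : LocallyLipschitzOn U f) {a b : ℝ}
    (hα : IsIntegralCurveIn f U (Icc a b) α) (hβ : IsIntegralCurveIn f U (Icc a b) β)
    (hab : α a = β a) : EqOn α β (Icc a b) := by
  set S : Set E := α '' Icc a b ∪ β '' Icc a b
  have hS : IsCompact S :=
    (isCompact_Icc.image_of_continuousOn hα.continuousOn).union
      (isCompact_Icc.image_of_continuousOn hβ.continuousOn)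
  have hSU : S ⊆ U := by
    rintro x (⟨t, ht, rfl⟩ | ⟨t, ht, rfl⟩)
    exacts [(hα t ht).1, (hβ t ht).1]
  obtain ⟨K, hK⟩ := (hf.mono hSU).exists_lipschitzOnWith_of_compact hS
  have key : ∀ γ : ℝ → E, IsIntegralCurveIn f U (Icc a b) γ →
      ∀ t ∈ Ico a b, HasDerivWithinAt γ (f (γ t)) (Ici t) t := fun γ hγ t ht =>
    (hγ t (Ico_subset_Icc_self ht)).2.mono_of_mem_nhdsWithin
      (mem_of_superset (Icc_mem_nhdsGE ht.2) (Icc_subset_Icc_left ht.1))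
  exact ODE_solution_unique_of_mem_Icc_right (v := fun _ => f) (s := fun _ => S)
    (fun _ _ => hK) hα.continuousOn (key α hα)
    (fun t ht => Or.inl ⟨t, Ico_subset_Icc_self ht, rfl⟩) hβ.continuousOn (key β hβ)
    (fun t ht => Or.inr ⟨t, Ico_subset_Icc_self ht, rfl⟩) hab

/-- The existence time `ε` is uniform over a ball of initial values. This is what allows a curve to
be continued when it merely accumulates at a point of `U`. -/
theorem exists_isIntegralCurveIn_of_mem_closedBall [CompleteSpace E] (hU : IsOpen U)
    (hf : LocallyLipschitzOn U f) {x : E} (hx : x ∈ U) :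
    ∃ r > 0, ∃ ε > 0, ∀ y ∈ Metric.closedBall x r, ∃ α : ℝ → E, α 0 = y ∧
      IsIntegralCurveIn f U (Icc 0 ε) α := by
  obtain ⟨K, S, hS, hK⟩ := hf hx
  rw [hU.nhdsWithin_eq hx] at hS
  obtain ⟨a, ha, haS⟩ := Metric.nhds_basis_closedBall.mem_iff.1 hS
  lift a to NNReal using ha.le
  have ha' : (0 : ℝ) < a := ha
  set M : NNReal := ‖f x‖₊ + K * a + 1 with hM
  have hM0 : (0 : ℝ) < M := by rw [hM]; push_cast; positivity
  have hbd : ∀ y ∈ Metric.closedBall x (a : ℝ), ‖f y‖ ≤ M := by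
    intro y hy
    have h1 := hK.dist_le_mul y (haS hy) x (haS (Metric.mem_closedBall_self ha'.le))
    have h2 : dist y x ≤ a := hy
    have h3 : ‖f y‖ ≤ ‖f x‖ + dist (f y) (f x) := by
      rw [dist_eq_norm]
      simpa using norm_add_le (f x) (f y - f x)
    have h4 : (K : ℝ) * dist y x ≤ K * a := mul_le_mul_of_nonneg_left h2 K.2
    rw [hM]; push_cast
    linarith
  -- With speed at most `M`, a curve started within `a / 2` of `x` travels at most `a / 2` and stays
  -- in the ball of radius `a`.
  set ε : ℝ := a / (2 * M) with hε
  have hε0 : 0 < ε := by positivity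
  have hpl : IsPicardLindelof (fun _ => f) (tmin := -ε) (tmax := ε)
      ⟨0, by constructor <;> linarith⟩ x a (a / 2) M K :=
    { lipschitzOnWith := fun _ _ => hK.mono haS
      continuousOn := fun _ _ => continuousOn_const
      norm_le := fun _ _ => hbd
      mul_max_le := by
        simp only [sub_zero, zero_sub, neg_neg, max_self, hε]
        push_cast
        have : (M : ℝ) * (a / (2 * M)) = a / 2 := by field_simp
        rw [this]; linarith }
  obtain ⟨Φ, hΦ, hΦc⟩ := hpl.exists_forall_mem_closedBall_eq_hasDerivWithinAt_continuousOn
  have hx0 : x ∈ Metric.closedBall x ((a / 2 : NNReal) : ℝ) :=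
    Metric.mem_closedBall_self (by positivity)
  have h0 : (0 : ℝ) ∈ Icc (-ε) ε := by constructor <;> linarith
  -- The solutions supplied by Picard–Lindelöf are not stated to stay in `U`; joint continuity of
  -- the flow at `(x, 0)` gives this after shrinking the ball and the time.
  have hnear : ∀ᶠ p in 𝓝[Metric.closedBall x ((a / 2 : NNReal) : ℝ) ×ˢ Icc (-ε) ε] (x, (0 : ℝ)),
      Φ p ∈ U := by
    refine (hΦc (x, 0) ⟨hx0, h0⟩).eventually (hU.mem_nhds ?_)
    have := (hΦ x hx0).1
    simp only at this
    rwa [this]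
  have hfull : Metric.closedBall x ((a / 2 : NNReal) : ℝ) ×ˢ Icc (-ε) ε ∈ 𝓝 (x, (0 : ℝ)) :=
    prod_mem_nhds (Metric.closedBall_mem_nhds _ (by push_cast; linarith))
      (Icc_mem_nhds (by linarith) hε0)
  rw [nhdsWithin_eq_nhds.2 hfull] at hnear
  obtain ⟨ρ, hρ, hρU⟩ := Metric.eventually_nhds_iff_ball.1 hnear
  refine ⟨min (a / 2) (ρ / 2), by positivity, min ε (ρ / 2), by positivity, fun y hy => ?_⟩
  have hya : y ∈ Metric.closedBall x ((a / 2 : NNReal) : ℝ) :=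
    Metric.closedBall_subset_closedBall (by push_cast; exact min_le_left _ _) hy
  refine ⟨fun t => Φ (y, t), (hΦ y hya).1, fun t ht => ⟨hρU _ ?_, ?_⟩⟩
  · have h1 : dist y x ≤ ρ / 2 := (Metric.mem_closedBall.1 hy).trans (min_le_right _ _)
    have h2 : t ≤ ρ / 2 := ht.2.trans (min_le_right _ _)
    rw [Metric.mem_ball, Prod.dist_eq, max_lt_iff]
    refine ⟨by simpa using by linarith, ?_⟩
    simp only [Real.dist_eq, sub_zero]
    rw [abs_of_nonneg ht.1]
    linarith
  · have hsub : Icc 0 (min ε (ρ / 2)) ⊆ Icc (-ε) ε :=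
      Icc_subset_Icc (by linarith) (min_le_left _ _)
    exact ((hΦ y hya).2 t (hsub ht)).mono hsub

/-- Integral curves with the same initial value, defined on larger and larger intervals, are
restrictions of one integral curve. -/
theorem exists_isIntegralCurveIn_of_forall (hf : LocallyLipschitzOn U f) {x : E}
    (hI : I ⊆ Ici 0) (h0 : (0 : ℝ) ∈ I)
    (h : ∀ t ∈ I, ∃ T > t, ∃ α : ℝ → E, α 0 = x ∧ IsIntegralCurveIn f U (Icc 0 T) α) :
    ∃ α : ℝ → E, α 0 = x ∧ IsIntegralCurveIn f U I α := by
  classical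
  choose! T hT β hβ0 hβ using h
  -- Diagonal choice: `β t` lives beyond time `t`, so by uniqueness the glued curve agrees with `β
  -- t` on a neighbourhood of `t` in `I`.
  refine ⟨fun t => β t t, hβ0 0 h0, fun t ht => ⟨(hβ t ht t ⟨hI ht, (hT t ht).le⟩).1, ?_⟩⟩
  have heq : ∀ s ∈ I, s < T t → β s s = β t s := by
    intro s hs hst
    have hs0 : (0 : ℝ) ≤ s := hI hs
    exact ((hβ s hs).mono (Icc_subset_Icc_right (hT s hs).le)).eqOn_Icc hf
      ((hβ t ht).mono (Icc_subset_Icc_right hst.le)) ((hβ0 s hs).trans (hβ0 t ht).symm)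
      ⟨hs0, le_rfl⟩
  have hev : ∀ᶠ s in 𝓝[I] t, s < T t := nhdsWithin_le_nhds (eventually_lt_nhds (hT t ht))
  have hd : HasDerivWithinAt (β t) (f (β t t)) I t := by
    refine (hβ t ht t ⟨hI ht, (hT t ht).le⟩).2.mono_of_mem_nhdsWithin ?_
    filter_upwards [hev, self_mem_nhdsWithin] with s hs hsI using ⟨hI hsI, hs.le⟩
  refine hd.congr_of_eventuallyEq ?_ rfl
  filter_upwards [hev, self_mem_nhdsWithin] with s hs hsI using heq s hsI hs

theorem IsIntegralCurveIn.concat {a c T ε : ℝ} (hα : IsIntegralCurveIn f U (Ico a T) α)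
    (hc : c ∈ Ico a T) (hβ : IsIntegralCurveIn f U (Icc 0 ε) β) (h : β 0 = α c) :
    IsIntegralCurveIn f U (Icc a (c + ε)) (fun t => if t ≤ c then α t else β (t - c)) := by
  intro t ht
  have hαc : IsIntegralCurveIn f U (Icc a c) α := hα.mono (Icc_subset_Ico_right hc.2)
  have hβc : IsIntegralCurveIn f U (Icc c (c + ε)) (fun t => β (t - c)) := by
    intro s hs
    have hs' : s - c ∈ Icc 0 ε := ⟨by linarith [hs.1], by linarith [hs.2]⟩
    refine ⟨(hβ _ hs').1, ?_⟩
    have h1 : HasDerivWithinAt (fun t : ℝ => t - c) 1 (Icc c (c + ε)) s :=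
      (hasDerivWithinAt_id s _).sub_const c
    have hmaps : MapsTo (fun t : ℝ => t - c) (Icc c (c + ε)) (Icc 0 ε) :=
      fun u hu => ⟨by linarith [hu.1], by linarith [hu.2]⟩
    simpa [Function.comp_def] using (hβ _ hs').2.scomp s h1 hmaps
  set g : ℝ → E := fun t => if t ≤ c then α t else β (t - c)
  have hg1 : ∀ s, s ≤ c → g s = α s := fun s hs => if_pos hs
  have hg2 : ∀ s, c ≤ s → g s = β (s - c) := by
    intro s hs
    rcases hs.eq_or_lt with rfl | hlt
    · rw [hg1 _ le_rfl, sub_self, h]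
    · exact if_neg hlt.not_ge
  have hU' : g t ∈ U := by
    rcases le_total t c with hle | hle
    · rw [hg1 _ hle]; exact (hαc t ⟨ht.1, hle⟩).1
    · rw [hg2 _ hle]; exact (hβc t ⟨hle, ht.2⟩).1
  refine ⟨hU', ?_⟩
  have hL : t ≤ c → HasDerivWithinAt g (f (g t)) (Icc a c) t := by
    intro hle
    rw [hg1 _ hle]
    exact (hαc t ⟨ht.1, hle⟩).2.congr (fun s hs => hg1 _ hs.2) (hg1 _ hle)
  have hR : c ≤ t → HasDerivWithinAt g (f (g t)) (Icc c (c + ε)) t := by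
    intro hle
    rw [hg2 _ hle]
    exact (hβc t ⟨hle, ht.2⟩).2.congr (fun s hs => hg2 _ hs.1) (hg2 _ hle)
  rcases lt_trichotomy t c with hlt | rfl | hlt
  · refine (hL hlt.le).mono_of_mem_nhdsWithin ?_
    filter_upwards [self_mem_nhdsWithin, nhdsWithin_le_nhds (eventually_lt_nhds hlt)]
      with s hs hsc using ⟨hs.1, hsc.le⟩
  · refine ((hL le_rfl).union (hR le_rfl)).mono ?_
    intro s hs
    rcases le_total s t with h' | h'
    exacts [Or.inl ⟨hs.1, h'⟩, Or.inr ⟨h', hs.2⟩]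
  · refine (hR hlt.le).mono_of_mem_nhdsWithin ?_
    filter_upwards [self_mem_nhdsWithin, nhdsWithin_le_nhds (eventually_gt_nhds hlt)]
      with s hs hsc using ⟨hsc.le, hs.2⟩

/-- If every integral curve on a bounded interval `[0, T)` starting at `x` accumulates in `U` as
`t → T`, then there is an integral curve on `[0, ∞)` starting at `x`. -/
theorem exists_isIntegralCurveIn_Ici [CompleteSpace E] (hU : IsOpen U)
    (hf : LocallyLipschitzOn U f) {x : E} (hx : x ∈ U)
    (hacc : ∀ T > 0, ∀ α : ℝ → E, α 0 = x → IsIntegralCurveIn f U (Ico 0 T) α →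
      ∃ y ∈ U, MapClusterPt y (𝓝[<] T) α) :
    ∃ α : ℝ → E, α 0 = x ∧ IsIntegralCurveIn f U (Ici 0) α := by
  suffices hall : ∀ t ≥ (0 : ℝ), ∃ T > t, ∃ α : ℝ → E, α 0 = x ∧
      IsIntegralCurveIn f U (Icc 0 T) α from
    exists_isIntegralCurveIn_of_forall hf Subset.rfl self_mem_Ici hall
  by_contra hcon
  push Not at hcon
  obtain ⟨t₀, ht₀, hno⟩ := hcon
  set S : Set ℝ := {T | 0 < T ∧ ∃ α : ℝ → E, α 0 = x ∧ IsIntegralCurveIn f U (Icc 0 T) α}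
  have hSb : BddAbove S := by
    refine ⟨t₀, fun T hT => ?_⟩
    by_contra hlt
    obtain ⟨α, hα0, hα⟩ := hT.2
    exact hno T (not_le.1 hlt) α hα0 hα
  obtain ⟨T₁, hT₁⟩ : S.Nonempty := by
    obtain ⟨r, hr, ε, hε, h⟩ := exists_isIntegralCurveIn_of_mem_closedBall hU hf hx
    exact ⟨ε, hε, h x (Metric.mem_closedBall_self hr.le)⟩
  have hpos : 0 < sSup S := hT₁.1.trans_le (le_csSup hSb hT₁)
  obtain ⟨α, hα0, hα⟩ := exists_isIntegralCurveIn_of_forall (x := x) (I := Ico 0 (sSup S)) hf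
    (fun t ht => ht.1) ⟨le_rfl, hpos⟩ fun t ht => by
      obtain ⟨T, hT, htT⟩ := exists_lt_of_lt_csSup ⟨T₁, hT₁⟩ ht.2
      exact ⟨T, htT, hT.2⟩
  obtain ⟨y, hy, hcl⟩ := hacc _ hpos α hα0 hα
  obtain ⟨r, hr, ε, hε, h⟩ := exists_isIntegralCurveIn_of_mem_closedBall hU hf hy
  -- Some time `c` within `ε` of the supremum has `α c` in the ball around `y`; restarting there
  -- gives a curve up to `c + ε`, beyond the supremum.
  have hfreq := (mapClusterPt_iff_frequently.1 hcl) _ (Metric.closedBall_mem_nhds y hr)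
  have hev : ∀ᶠ t in 𝓝[<] (sSup S), t ∈ Ioo (max 0 (sSup S - ε)) (sSup S) :=
    Ioo_mem_nhdsLT (max_lt hpos (by linarith))
  obtain ⟨c, hcr, hc⟩ := (hfreq.and_eventually hev).exists
  obtain ⟨β, hβ0, hβ⟩ := h _ hcr
  have hc0 : 0 ≤ c := (le_max_left _ _).trans hc.1.le
  have hcε : sSup S - ε < c := (le_max_right _ _).trans_lt hc.1
  have hmem : c + ε ∈ S := by
    refine ⟨by linarith, _, ?_, hα.concat ⟨hc0, hc.2⟩ hβ hβ0⟩
    simp [hc0, hα0]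
  linarith [le_csSup hSb hmem]

theorem IsIntegralCurveIn.comp_neg (hα : IsIntegralCurveIn f U univ α) :
    IsIntegralCurveIn (-f) U univ (fun t => α (-t)) := by
  intro t _
  refine ⟨(hα (-t) (mem_univ _)).1, ?_⟩
  have := (hα (-t) (mem_univ _)).2.scomp t (hasDerivAt_neg t).hasDerivWithinAt
    (mapsTo_univ _ univ)
  simpa [Function.comp_def] using this

theorem IsIntegralCurveIn.eq_of_univ (hf : LocallyLipschitzOn U f)
    (hα : IsIntegralCurveIn f U univ α) (hβ : IsIntegralCurveIn f U univ β) (h0 : α 0 = β 0) :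
    α = β := by
  funext t
  rcases le_total 0 t with ht | ht
  · exact (hα.mono (subset_univ (Icc 0 t))).eqOn_Icc hf (hβ.mono (subset_univ _)) h0 ⟨ht, le_rfl⟩
  · have h := (hα.comp_neg.mono (subset_univ (Icc 0 (-t)))).eqOn_Icc hf.neg
      (hβ.comp_neg.mono (subset_univ _)) (by simpa using h0)
      (show -t ∈ Icc 0 (-t) from ⟨by linarith, le_rfl⟩)
    simpa using h

theorem IsIntegralCurveIn.exists_univ (hα : IsIntegralCurveIn f U (Ici 0) α)
    (hβ : IsIntegralCurveIn f U (Iic 0) β) (h0 : β 0 = α 0) :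
    ∃ z : ℝ → E, z 0 = α 0 ∧ IsIntegralCurveIn f U univ z := by
  classical
  set g : ℝ → E := fun t => if 0 ≤ t then α t else β t
  have hg1 : ∀ s, 0 ≤ s → g s = α s := fun s hs => if_pos hs
  have hg2 : ∀ s, s ≤ 0 → g s = β s := by
    intro s hs
    rcases hs.eq_or_lt with rfl | hlt
    · rw [hg1 _ le_rfl, h0]
    · exact if_neg hlt.not_ge
  have hL : IsIntegralCurveIn f U (Iic 0) g := fun t ht => by
    rw [hg2 t ht]
    exact ⟨(hβ t ht).1, (hβ t ht).2.congr hg2 (hg2 t ht)⟩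
  have hR : IsIntegralCurveIn f U (Ici 0) g := fun t ht => by
    rw [hg1 t ht]
    exact ⟨(hα t ht).1, (hα t ht).2.congr hg1 (hg1 t ht)⟩
  refine ⟨g, hg1 0 le_rfl, fun t _ => ?_⟩
  rcases lt_trichotomy t 0 with hlt | rfl | hlt
  · exact ⟨(hL t hlt.le).1, ((hL t hlt.le).2.hasDerivAt (Iic_mem_nhds hlt)).hasDerivWithinAt⟩
  · refine ⟨(hL 0 self_mem_Iic).1, ?_⟩
    rw [← Iic_union_Ici (a := (0 : ℝ))]
    exact (hL 0 self_mem_Iic).2.union (hR 0 self_mem_Ici).2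
  · exact ⟨(hR t hlt.le).1, ((hR t hlt.le).2.hasDerivAt (Ici_mem_nhds hlt)).hasDerivWithinAt⟩

end ODE

/-! ### The plane -/

theorem inner_plane (u v : Plane) : inner ℝ u v = u 0 * v 0 + u 1 * v 1 := by
  simp [PiLp.inner_apply, Fin.sum_univ_two, mul_comm]

@[simp] theorem rot_zero_apply (v : Plane) : rot v 0 = -(v 1) := rfl

@[simp] theorem rot_one_apply (v : Plane) : rot v 1 = v 0 := rfl

theorem plane_ext {u v : Plane} (h0 : u 0 = v 0) (h1 : u 1 = v 1) : u = v := by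
  ext i; fin_cases i
  exacts [h0, h1]

/-- The rotation `rot` as a continuous linear map. -/
noncomputable def rotCLM : Plane →L[ℝ] Plane :=
  LinearMap.toContinuousLinearMap
    { toFun := rot
      map_add' := fun u v => plane_ext (by simp; ring) (by simp)
      map_smul' := fun c v => plane_ext (by simp) (by simp) }

theorem rotCLM_apply (v : Plane) : rotCLM v = rot v := rfl

theorem rot_rot (v : Plane) : rot (rot v) = -v := plane_ext (by simp) (by simp)

theorem rot_smul (c : ℝ) (v : Plane) : rot (c • v) = c • rot v := rotCLM.map_smul c v

theorem rot_neg (v : Plane) : rot (-v) = -rot v := rotCLM.map_neg v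

theorem inner_rot_self (v : Plane) : inner ℝ v (rot v) = 0 := by
  rw [inner_plane]; simp; ring

theorem inner_rot_left (u v : Plane) : inner ℝ (rot u) v = -inner ℝ u (rot v) := by
  simp only [inner_plane, rot_zero_apply, rot_one_apply]; ring

theorem norm_rot (v : Plane) : ‖rot v‖ = ‖v‖ := by
  have h : ‖rot v‖ ^ 2 = ‖v‖ ^ 2 := by
    rw [← real_inner_self_eq_norm_sq, ← real_inner_self_eq_norm_sq]
    simp only [inner_plane, rot_zero_apply, rot_one_apply]; ring
  exact (pow_left_inj₀ (norm_nonneg _) (norm_nonneg _) two_ne_zero).1 h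

/-! ### The equations of motion in position and velocity -/

/-- The vector field of the equations of motion `q' = v`, `v' = -b(q) rot v`. -/
noncomputable def lorentzField (b : Plane → ℝ) (x : Plane × Plane) : Plane × Plane :=
  (x.2, -(b x.1) • rot x.2)

/-- The field is a smooth map of the pair `(b(q), v)`, so the regularity of `b` is inherited. -/
theorem locallyLipschitzOn_lorentzField {Ω : Set Plane} {b : Plane → ℝ}
    (hb : LocallyLipschitzOn Ω b) :
    LocallyLipschitzOn (Ω ×ˢ (univ : Set Plane)) (lorentzField b) := by
  rw [locallyLipschitzOn_iff_restrict]
  have hg : LocallyLipschitz (fun y : ℝ × Plane => (y.2, -y.1 • rotCLM y.2)) := by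
    have : ContDiff ℝ 1 (fun y : ℝ × Plane => (y.2, -y.1 • rotCLM y.2)) := by fun_prop
    exact this.locallyLipschitz
  have hπ : LipschitzWith 1
      (fun x : (Ω ×ˢ (univ : Set Plane) : Set (Plane × Plane)) => (⟨x.1.1, x.2.1⟩ : Ω)) :=
    LipschitzWith.of_edist_le fun x y => by
      rw [Subtype.edist_eq, Subtype.edist_eq, Prod.edist_eq]; exact le_max_left _ _
  have hp : LocallyLipschitz
      (fun x : (Ω ×ˢ (univ : Set Plane) : Set (Plane × Plane)) => (b x.1.1, x.1.2)) :=
    (hb.restrict.comp hπ.locallyLipschitz).prodMk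
      (LipschitzWith.prod_snd.comp (LipschitzWith.subtype_val _)).locallyLipschitz
  have heq : (Ω ×ˢ (univ : Set Plane)).domRestrict (lorentzField b)
      = (fun y : ℝ × Plane => (y.2, -y.1 • rotCLM y.2)) ∘ fun x => (b x.1.1, x.1.2) := by
    funext x
    simp only [Set.domRestrict_apply, lorentzField, Function.comp_apply, rotCLM_apply]
  rw [heq]
  exact hg.comp hp

theorem gradient_hamiltonian_momentum (A : Plane → Plane) (q p : Plane) :
    gradient (fun p => hamiltonian A q p) p = p - A q := by
  apply HasGradientAt.gradient
  rw [hasGradientAt_iff_hasFDerivAt]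
  have h1 : HasFDerivAt (fun p : Plane => p - A q) (ContinuousLinearMap.id ℝ Plane) p :=
    (hasFDerivAt_id p).sub_const _
  have h2 := h1.norm_sq.mul_const (1 / 2 : ℝ)
  have h3 : (fun p => hamiltonian A q p) = fun p => ‖p - A q‖ ^ 2 * (1 / 2 : ℝ) := by
    funext p; simp [hamiltonian]; ring
  rw [h3]
  refine h2.congr_fderiv ?_
  ext w
  simp

theorem gradient_hamiltonian_position {A : Plane → Plane} {q : Plane}
    (hA : DifferentiableAt ℝ A q) (p : Plane) :
    -gradient (fun q => hamiltonian A q p) q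
      = ContinuousLinearMap.adjoint (fderiv ℝ A q) (p - A q) := by
  rw [neg_eq_iff_eq_neg]
  apply HasGradientAt.gradient
  rw [hasGradientAt_iff_hasFDerivAt]
  have h1 : HasFDerivAt (fun q : Plane => p - A q) (-fderiv ℝ A q) q :=
    hA.hasFDerivAt.const_sub _
  have h2 := h1.norm_sq.mul_const (1 / 2 : ℝ)
  have h3 : (fun q => hamiltonian A q p) = fun q => ‖p - A q‖ ^ 2 * (1 / 2 : ℝ) := by
    funext p; simp [hamiltonian]; ring
  rw [h3]
  refine h2.congr_fderiv ?_
  ext w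
  simp [ContinuousLinearMap.adjoint_inner_left]

/-- The antisymmetric part of the differential of a vector potential is the magnetic field. -/
theorem IsVectorPotential.adjoint_sub_fderiv {Ω : Set Plane} {A : Plane → Plane} {b : Plane → ℝ}
    (hA : IsVectorPotential Ω A b) {q : Plane} (hq : q ∈ Ω) (v : Plane) :
    ContinuousLinearMap.adjoint (fderiv ℝ A q) v - fderiv ℝ A q v = -(b q) • rot v := by
  set D := fderiv ℝ A q
  have hb : (D (EuclideanSpace.single 0 1)) 1 - (D (EuclideanSpace.single 1 1)) 0 = b q :=
    hA.2 q hq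
  have hv : v = v 0 • EuclideanSpace.single 0 (1 : ℝ) + v 1 • EuclideanSpace.single 1 (1 : ℝ) :=
    plane_ext (by simp) (by simp)
  have hDv : D v = v 0 • D (EuclideanSpace.single 0 1) + v 1 • D (EuclideanSpace.single 1 1) := by
    conv_lhs => rw [hv]
    simp
  have hadj : ∀ i : Fin 2, (ContinuousLinearMap.adjoint D v) i
      = v 0 * (D (EuclideanSpace.single i 1)) 0 + v 1 * (D (EuclideanSpace.single i 1)) 1 := by
    intro i
    have h1 : (ContinuousLinearMap.adjoint D v) i
        = inner ℝ (ContinuousLinearMap.adjoint D v) (EuclideanSpace.single i (1 : ℝ)) := by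
      rw [EuclideanSpace.inner_single_right]; simp
    rw [h1, ContinuousLinearMap.adjoint_inner_left, inner_plane]
  apply plane_ext
  · simp only [PiLp.sub_apply, hadj, hDv, PiLp.add_apply, PiLp.smul_apply, smul_eq_mul,
      rot_zero_apply]
    rw [← hb]; ring
  · simp only [PiLp.sub_apply, hadj, hDv, PiLp.add_apply, PiLp.smul_apply, smul_eq_mul,
      rot_one_apply]
    rw [← hb]; ring

/-- Replacing the momentum `p` by the velocity `p - A(q)` turns Hamilton's equations into
`q' = v`, `v' = -b(q) rot v`. -/
theorem IsVectorPotential.isIntegralCurveIn {Ω : Set Plane} (hΩ : IsOpen Ω) {A : Plane → Plane}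
    {b : Plane → ℝ} (hA : IsVectorPotential Ω A b) {I : Set ℝ} {z : ℝ → Plane × Plane}
    (hz : IsTrajectoryOn Ω A I z) :
    IsIntegralCurveIn (lorentzField b) (Ω ×ˢ univ) I
      (fun t => ((z t).1, (z t).2 - A (z t).1)) := by
  intro t ht
  obtain ⟨hq, h1, h2⟩ := hz t ht
  have hAd : DifferentiableAt ℝ A (z t).1 :=
    (hA.1.contDiffAt (hΩ.mem_nhds hq)).differentiableAt one_ne_zero
  rw [gradient_hamiltonian_momentum] at h1
  rw [gradient_hamiltonian_position hAd] at h2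
  refine ⟨⟨hq, mem_univ _⟩, h1.prodMk ?_⟩
  rw [← hA.adjoint_sub_fderiv hq]
  exact h2.sub (hAd.hasFDerivAt.comp_hasDerivWithinAt t h1)

theorem IsVectorPotential.isTrajectoryOn {Ω : Set Plane} (hΩ : IsOpen Ω) {A : Plane → Plane}
    {b : Plane → ℝ} (hA : IsVectorPotential Ω A b) {I : Set ℝ} {z : ℝ → Plane × Plane}
    (hz : IsIntegralCurveIn (lorentzField b) (Ω ×ˢ univ) I z) :
    IsTrajectoryOn Ω A I (fun t => ((z t).1, (z t).2 + A (z t).1)) := by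
  intro t ht
  obtain ⟨⟨hq, -⟩, h⟩ := hz t ht
  have hAd : DifferentiableAt ℝ A (z t).1 :=
    (hA.1.contDiffAt (hΩ.mem_nhds hq)).differentiableAt one_ne_zero
  have h1 : HasDerivWithinAt (fun τ => (z τ).1) (z t).2 I t := h.fst
  have h2 : HasDerivWithinAt (fun τ => (z τ).2) (-(b (z t).1) • rot (z t).2) I t := h.snd
  refine ⟨hq, ?_, ?_⟩
  · rw [gradient_hamiltonian_momentum]
    simpa using h1
  · rw [gradient_hamiltonian_position hAd]
    have := h2.add (hAd.hasFDerivAt.comp_hasDerivWithinAt t h1)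
    rw [← hA.adjoint_sub_fderiv hq, sub_add_cancel] at this
    simp only [add_sub_cancel_right]
    exact this

section Motion

variable {Ω : Set Plane} {b : Plane → ℝ} {z : ℝ → Plane × Plane}

/-- The magnetic force is orthogonal to the velocity and does no work. -/
theorem norm_velocity_eq {T : ℝ}
    (hz : IsIntegralCurveIn (lorentzField b) (Ω ×ˢ univ) (Ico 0 T) z) {t : ℝ} (ht : t ∈ Ico 0 T) :
    ‖(z t).2‖ = ‖(z 0).2‖ := by
  have hz' := hz.mono (Icc_subset_Ico_right ht.2 : Icc 0 t ⊆ Ico 0 T)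
  have hd : ∀ s ∈ Icc 0 t, HasDerivWithinAt (fun τ => ‖(z τ).2‖ ^ 2) 0 (Icc 0 t) s := by
    intro s hs
    have h2 : HasDerivWithinAt (fun τ => (z τ).2) (-(b (z s).1) • rot (z s).2) (Icc 0 t) s :=
      (hz' s hs).2.snd
    have := h2.norm_sq
    rwa [inner_smul_right, inner_rot_self, mul_zero, mul_zero] at this
  have h := constant_of_has_deriv_right_zero (f := fun τ => ‖(z τ).2‖ ^ 2) (a := 0) (b := t)
    (fun s hs => (hd s hs).continuousWithinAt)
    (fun s hs => (hd s (Ico_subset_Icc_self hs)).mono_of_mem_nhdsWithin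
      (mem_of_superset (Icc_mem_nhdsGE hs.2) (Icc_subset_Icc_left hs.1))) t ⟨ht.1, le_rfl⟩
  exact (pow_left_inj₀ (norm_nonneg _) (norm_nonneg _) two_ne_zero).1 h

/-- The motion with the field `-b` is the motion with the field `b` run backwards. -/
theorem isIntegralCurveIn_reverse
    (hz : IsIntegralCurveIn (lorentzField fun q => -b q) (Ω ×ˢ univ) (Ici 0) z) :
    IsIntegralCurveIn (lorentzField b) (Ω ×ˢ univ) (Iic 0)
      (fun t => ((z (-t)).1, -(z (-t)).2)) := by
  intro t ht
  have ht' : -t ∈ Ici (0 : ℝ) := by simpa using ht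
  obtain ⟨⟨hq, -⟩, h⟩ := hz (-t) ht'
  have hneg : HasDerivWithinAt (fun t : ℝ => -t) (-1) (Iic 0) t :=
    (hasDerivAt_neg t).hasDerivWithinAt
  have hmaps : MapsTo (fun t : ℝ => -t) (Iic 0) (Ici 0) := fun s hs => by simpa using hs
  have h1 : HasDerivWithinAt (fun τ => (z τ).1) (z (-t)).2 (Ici 0) (-t) := h.fst
  have h2 : HasDerivWithinAt (fun τ => (z τ).2) (-(-b (z (-t)).1) • rot (z (-t)).2)
    (Ici 0) (-t) := h.snd
  refine ⟨⟨hq, mem_univ _⟩, HasDerivWithinAt.prodMk ?_ ?_⟩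
  · simpa [Function.comp_def] using h1.scomp t hneg hmaps
  · have := (h2.scomp t hneg hmaps).neg
    simp only [neg_neg, neg_smul, one_smul] at this
    simp only [rot_neg, smul_neg, neg_smul, neg_neg]
    exact this

end Motion

/-! ### The Frenet frame and tubular coordinates -/

theorem eq_frame {τ : Plane} (hτ : ‖τ‖ = 1) (u : Plane) :
    u = inner ℝ u τ • τ + inner ℝ u (rot τ) • rot τ := by
  have h : τ 0 * τ 0 + τ 1 * τ 1 = 1 := by
    rw [← inner_plane, real_inner_self_eq_norm_sq, hτ]; norm_num
  simp only [inner_plane, rot_zero_apply, rot_one_apply]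
  apply plane_ext
  · simp only [PiLp.add_apply, PiLp.smul_apply, smul_eq_mul, rot_zero_apply]
    linear_combination (-(u 0)) * h
  · simp only [PiLp.add_apply, PiLp.smul_apply, smul_eq_mul, rot_one_apply]
    linear_combination (-(u 1)) * h

theorem norm_normal (γ : ℝ → Plane) (s : ℝ) : ‖normal γ s‖ = ‖deriv γ s‖ := norm_rot _

theorem exists_norm_le_of_periodic {F : Type*} [NormedAddCommGroup F] {g : ℝ → F} {L : ℝ}
    (hL : 0 < L) (hg : Continuous g) (hp : Function.Periodic g L) : ∃ M, 0 ≤ M ∧ ∀ s, ‖g s‖ ≤ M := by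
  obtain ⟨M, hM⟩ := isCompact_Icc.exists_bound_of_continuousOn (s := Icc 0 L) hg.continuousOn
  refine ⟨M, (norm_nonneg _).trans (hM 0 ⟨le_rfl, hL.le⟩), fun s => ?_⟩
  obtain ⟨y, hy, hys⟩ := hp.exists_mem_Ico₀ hL s
  rw [hys]
  exact hM y (Ico_subset_Icc_self hy)

theorem periodic_deriv {F : Type*} [NormedAddCommGroup F] [NormedSpace ℝ F] {g : ℝ → F} {L : ℝ}
    (hp : Function.Periodic g L) : Function.Periodic (deriv g) L := by
  intro s
  have h : (fun x => g (x + L)) = g := funext hp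
  rw [← deriv_comp_add_const, h]

namespace IsArcLengthParam

variable {C : Set Plane} {γ : ℝ → Plane} {L : ℝ}

theorem contDiff_deriv (h : IsArcLengthParam C γ L) : ContDiff ℝ 1 (deriv γ) :=
  h.contDiff.deriv'

theorem hasDerivAt (h : IsArcLengthParam C γ L) (s : ℝ) : HasDerivAt γ (deriv γ s) s :=
  (h.contDiff.differentiable two_ne_zero s).hasDerivAt

theorem inner_deriv_deriv (h : IsArcLengthParam C γ L) (s : ℝ) :
    inner ℝ (deriv (deriv γ) s) (deriv γ s) = 0 := by
  have hd : HasDerivAt (deriv γ) (deriv (deriv γ) s) s :=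
    (h.contDiff_deriv.differentiable one_ne_zero s).hasDerivAt
  have h1 := hd.norm_sq
  have h2 : (fun x => ‖deriv γ x‖ ^ 2) = fun _ => (1 : ℝ) := by
    funext x; rw [h.unit_speed]; norm_num
  rw [h2] at h1
  have h3 := h1.unique (hasDerivAt_const s (1 : ℝ))
  rw [real_inner_comm]
  linarith

/-- Unit speed kills the tangential component of `γ''`, leaving only the normal one. -/
theorem hasDerivAt_deriv (h : IsArcLengthParam C γ L) (s : ℝ) :
    HasDerivAt (deriv γ) (curvature γ s • normal γ s) s := by
  have hd : HasDerivAt (deriv γ) (deriv (deriv γ) s) s :=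
    (h.contDiff_deriv.differentiable one_ne_zero s).hasDerivAt
  have he := eq_frame (h.unit_speed s) (deriv (deriv γ) s)
  rw [h.inner_deriv_deriv, zero_smul, zero_add] at he
  rw [he] at hd
  exact hd

theorem hasDerivAt_normal (h : IsArcLengthParam C γ L) (s : ℝ) :
    HasDerivAt (normal γ) (-curvature γ s • deriv γ s) s := by
  have h1 := rotCLM.hasFDerivAt.comp_hasDerivAt s (h.hasDerivAt_deriv s)
  rw [rotCLM_apply, rot_smul, normal, rot_rot, smul_neg, ← neg_smul] at h1
  exact h1

theorem contDiff_normal (h : IsArcLengthParam C γ L) : ContDiff ℝ 1 (normal γ) :=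
  rotCLM.contDiff.comp h.contDiff_deriv

theorem continuous_curvature (h : IsArcLengthParam C γ L) : Continuous (curvature γ) :=
  (h.contDiff_deriv.continuous_deriv_one).inner h.contDiff_normal.continuous

theorem periodic_curvature (h : IsArcLengthParam C γ L) : Function.Periodic (curvature γ) L := by
  intro s
  simp only [curvature, normal, periodic_deriv h.periodic s,
    periodic_deriv (periodic_deriv h.periodic) s]

theorem exists_abs_curvature_le (h : IsArcLengthParam C γ L) :
    ∃ k, 0 ≤ k ∧ ∀ s, |curvature γ s| ≤ k :=
  exists_norm_le_of_periodic h.length_pos h.continuous_curvature h.periodic_curvature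

/-- `κ` is the inner product of `γ''` and `N`, both bounded and Lipschitz. -/
theorem exists_abs_curvature_sub_le (h : IsArcLengthParam C γ L) :
    ∃ k, 0 ≤ k ∧ ∀ s s', |curvature γ s - curvature γ s'| ≤ k * |s - s'| := by
  obtain ⟨K, hK⟩ := h.lipschitz
  obtain ⟨M, hM0, hM⟩ := exists_norm_le_of_periodic h.length_pos
    h.contDiff_deriv.continuous_deriv_one (periodic_deriv (periodic_deriv h.periodic))
  obtain ⟨k, hk0, hk⟩ := h.exists_abs_curvature_le
  refine ⟨K + M * k, by positivity, fun s s' => ?_⟩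
  have hN : ‖normal γ s - normal γ s'‖ ≤ k * ‖s - s'‖ := by
    refine Convex.norm_image_sub_le_of_norm_hasDerivWithin_le (s := univ)
      (fun x _ => (h.hasDerivAt_normal x).hasDerivWithinAt) (fun x _ => ?_) convex_univ
      (mem_univ s') (mem_univ s)
    rw [norm_smul, norm_neg, h.unit_speed, mul_one]
    exact hk x
  have h1 : curvature γ s - curvature γ s'
      = inner ℝ (deriv (deriv γ) s - deriv (deriv γ) s') (normal γ s)
        + inner ℝ (deriv (deriv γ) s') (normal γ s - normal γ s') := by
    rw [inner_sub_left, inner_sub_right]; simp only [curvature]; ring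
  have h2 : |inner ℝ (deriv (deriv γ) s - deriv (deriv γ) s') (normal γ s)| ≤ K * |s - s'| := by
    refine (abs_real_inner_le_norm _ _).trans ?_
    rw [norm_normal, h.unit_speed, mul_one]
    simpa [dist_eq_norm] using hK.dist_le_mul s s'
  have h3 : |inner ℝ (deriv (deriv γ) s') (normal γ s - normal γ s')| ≤ M * (k * |s - s'|) :=
    (abs_real_inner_le_norm _ _).trans
      (mul_le_mul (hM s') hN (norm_nonneg _) hM0)
  rw [h1]
  refine (abs_add_le _ _).trans ?_
  linarith

theorem contDiff_tubularMap (h : IsArcLengthParam C γ L) : ContDiff ℝ 1 (tubularMap γ) := by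
  have h1 : ContDiff ℝ 1 γ := h.contDiff.of_le one_le_two
  have h2 := h.contDiff_normal
  exact (h1.comp contDiff_snd).add (contDiff_fst.smul (h2.comp contDiff_snd))

theorem tubularMap_periodic (h : IsArcLengthParam C γ L) (n : ℝ) :
    Function.Periodic (fun s => tubularMap γ (n, s)) L := by
  intro s
  simp only [tubularMap, normal, h.periodic s, periodic_deriv h.periodic s]

/-- The differential `(ν, σ) ↦ ν N + σ (1 - n κ) γ'` of the tubular map, where it is invertible. -/
noncomputable def tubularDeriv (h : IsArcLengthParam C γ L) (n s : ℝ)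
    (hns : 1 - n * curvature γ s ≠ 0) : (ℝ × ℝ) ≃L[ℝ] Plane :=
  ContinuousLinearEquiv.equivOfInverse
    ((ContinuousLinearMap.fst ℝ ℝ ℝ).smulRight (normal γ s)
      + ((1 - n * curvature γ s) • ContinuousLinearMap.snd ℝ ℝ ℝ).smulRight (deriv γ s))
    ((innerSL ℝ (normal γ s)).prod ((1 - n * curvature γ s)⁻¹ • innerSL ℝ (deriv γ s)))
    (by
      intro x
      have hTN : inner ℝ (deriv γ s) (normal γ s) = 0 := inner_rot_self _
      have hNT : inner ℝ (normal γ s) (deriv γ s) = 0 := by rw [real_inner_comm, hTN]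
      ext
      · simp [inner_add_right, inner_smul_right, hNT, norm_normal, h.unit_speed]
      · simp [inner_add_right, inner_smul_right, hTN, hns, h.unit_speed])
    (by
      intro u
      conv_rhs => rw [eq_frame (h.unit_speed s) u]
      simp only [ContinuousLinearMap.prod_apply, innerSL_apply_apply, _root_.smul_apply,
        _root_.add_apply, ContinuousLinearMap.smulRight_apply,
        ContinuousLinearMap.coe_fst', ContinuousLinearMap.coe_snd', smul_eq_mul]
      rw [mul_inv_cancel_left₀ hns, real_inner_comm u, real_inner_comm u, add_comm]
      rfl)

theorem hasStrictFDerivAt_tubularMap (h : IsArcLengthParam C γ L) (n s : ℝ)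
    (hns : 1 - n * curvature γ s ≠ 0) :
    HasStrictFDerivAt (tubularMap γ) (h.tubularDeriv n s hns : ℝ × ℝ →L[ℝ] Plane) (n, s) := by
  refine h.contDiff_tubularMap.contDiffAt.hasStrictFDerivAt' ?_ one_ne_zero
  have h1 : HasFDerivAt (fun x : ℝ × ℝ => γ x.2) _ (n, s) :=
    HasFDerivAt.comp (g := γ) (f := Prod.snd) (n, s) (h.hasDerivAt s).hasFDerivAt hasFDerivAt_snd
  have h2 : HasFDerivAt (fun x : ℝ × ℝ => normal γ x.2) _ (n, s) :=
    HasFDerivAt.comp (g := normal γ) (f := Prod.snd) (n, s) (h.hasDerivAt_normal s).hasFDerivAt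
      hasFDerivAt_snd
  have h3 := h1.add ((hasFDerivAt_fst (𝕜 := ℝ) (p := ((n, s) : ℝ × ℝ))).smul h2)
  refine h3.congr_fderiv ?_
  ext1
  · ext1
    simp [tubularDeriv]
  · ext1
    simp only [tubularDeriv]
    simp
    module

/-- A curve in the plane can be written in tubular coordinates near each of its points where the
tubular map is regular. -/
theorem exists_tubular_lift (h : IsArcLengthParam C γ L) {q : ℝ → Plane} {v : Plane} {t n s : ℝ}
    (hns : 1 - n * curvature γ s ≠ 0) (hq : HasDerivAt q v t) (hqt : q t = tubularMap γ (n, s)) :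
    ∃ ν σ : ℝ → ℝ, ν t = n ∧ σ t = s ∧ (∀ᶠ τ in 𝓝 t, tubularMap γ (ν τ, σ τ) = q τ) ∧
      HasDerivAt ν (inner ℝ v (normal γ s)) t ∧
      HasDerivAt σ ((1 - n * curvature γ s)⁻¹ * inner ℝ v (deriv γ s)) t := by
  have hs := h.hasStrictFDerivAt_tubularMap n s hns
  set g := hs.localInverse (tubularMap γ) (h.tubularDeriv n s hns) (n, s) with hg
  have hgq : g (q t) = (n, s) := by rw [hqt]; exact hs.localInverse_apply_image
  have hev := hs.eventually_right_inverse
  rw [← hqt] at hev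
  have hd : HasDerivAt (fun τ => g (q τ)) ((h.tubularDeriv n s hns).symm v) t := by
    have h1 := hs.to_localInverse.hasFDerivAt
    rw [← hqt] at h1
    exact h1.comp_hasDerivAt t hq
  refine ⟨fun τ => (g (q τ)).1, fun τ => (g (q τ)).2, by simp [hgq], by simp [hgq],
    hq.continuousAt.eventually hev, ?_, ?_⟩
  · rw [real_inner_comm]
    exact hd.fst
  · rw [real_inner_comm]
    exact hd.snd

end IsArcLengthParam

namespace IsTubularWidth

variable {Ω C : Set Plane} {γ : ℝ → Plane} {L δ : ℝ}

theorem tubularMap_mem (hδ : IsTubularWidth Ω C γ L δ) (h : IsArcLengthParam C γ L) {n : ℝ}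
    (hn : n ∈ Ioo 0 δ) (s : ℝ) : tubularMap γ (n, s) ∈ Ω := by
  obtain ⟨y, hy, hys⟩ := (h.tubularMap_periodic n).exists_mem_Ico₀ h.length_pos s
  rw [hys]
  exact ((hδ.bijOn δ ⟨hδ.pos, le_rfl⟩).mapsTo ⟨hn, hy⟩).1

/-- Tubular coordinates are unique up to periodicity. -/
theorem eq_of_tubularMap_eq (hδ : IsTubularWidth Ω C γ L δ) (h : IsArcLengthParam C γ L)
    {n n' s s' : ℝ} (hn : n ∈ Ioo 0 δ) (hn' : n' ∈ Ioo 0 δ)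
    (heq : tubularMap γ (n, s) = tubularMap γ (n', s')) :
    n = n' ∧ deriv γ s = deriv γ s' ∧ curvature γ s = curvature γ s' := by
  have key : ∀ m r : ℝ, ∃ y ∈ Ico 0 L, tubularMap γ (m, r) = tubularMap γ (m, y) ∧
      deriv γ r = deriv γ y ∧ curvature γ r = curvature γ y := by
    intro m r
    have hp : Function.Periodic
        (fun r => (tubularMap γ (m, r), deriv γ r, curvature γ r)) L := fun r => by
      have := h.tubularMap_periodic m r
      simp only at this
      simp only [this, periodic_deriv h.periodic r, h.periodic_curvature r]
    obtain ⟨y, hy, hys⟩ := hp.exists_mem_Ico₀ h.length_pos r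
    simp only [Prod.mk.injEq] at hys
    exact ⟨y, hy, hys⟩
  obtain ⟨y, hy, h1, h2, h3⟩ := key n s
  obtain ⟨y', hy', h1', h2', h3'⟩ := key n' s'
  have hinj : (n, y) = (n', y') := (hδ.bijOn δ ⟨hδ.pos, le_rfl⟩).injOn (mk_mem_prod hn hy)
    (mk_mem_prod hn' hy') (by rw [← h1, ← h1', heq])
  obtain ⟨e1, e2⟩ := Prod.mk.inj hinj
  exact ⟨e1, by rw [h2, h2', e2], by rw [h3, h3', e2]⟩

end IsTubularWidth

/-! ### Local Lipschitz bounds -/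

theorem eventually_abs_sub_le_of_hasDerivAt {g : ℝ → ℝ} {g' K t : ℝ} (hg : HasDerivAt g g' t)
    (hK : |g'| < K) : ∀ᶠ τ in 𝓝 t, |g τ - g t| ≤ K * |τ - t| := by
  have h := (hasDerivAt_iff_isLittleO.1 hg).def (sub_pos.2 hK)
  filter_upwards [h] with τ hτ
  simp only [smul_eq_mul, Real.norm_eq_abs] at hτ
  have h1 : g τ - g t = (g τ - g t - (τ - t) * g') + (τ - t) * g' := by ring
  rw [h1]
  refine (abs_add_le _ _).trans ?_
  rw [abs_mul (τ - t) g']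
  linarith

/-- The neighbourhoods in the hypothesis depend on `t`, so the estimates are integrated by a
comparison theorem; its strict inequality between slopes costs the `+ 1`. -/
theorem abs_sub_le_of_eventually_abs_sub_le {F : ℝ → ℝ} {K a b : ℝ} (hab : a ≤ b)
    (h : ∀ t ∈ Icc a b, ∀ᶠ τ in 𝓝 t, |F τ - F t| ≤ K * |τ - t|) :
    |F b - F a| ≤ (K + 1) * (b - a) := by
  have hcont : ∀ t ∈ Icc a b, ContinuousAt F t := by
    intro t ht
    rw [ContinuousAt, tendsto_iff_dist_tendsto_zero]
    refine squeeze_zero' (Eventually.of_forall fun _ => dist_nonneg) (h t ht) ?_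
    exact Continuous.tendsto' (by fun_prop) t 0 (by simp)
  have hB : ∀ t : ℝ, HasDerivAt (fun t => (K + 1) * (t - a)) (K + 1) t := fun t => by
    simpa using ((hasDerivAt_id t).sub_const a).const_mul (K + 1)
  refine image_norm_le_of_liminf_right_slope_norm_lt_deriv_boundary
    (f := fun t => F t - F a) (f' := fun _ => K) (a := a) (b := b)
    (B := fun t => (K + 1) * (t - a)) (B' := fun _ => K + 1)
    (fun t ht => ((hcont t ht).sub continuousAt_const).continuousWithinAt) ?_ (by simp)
    (fun t _ => (hB t).continuousAt.continuousWithinAt) (fun t _ => (hB t).hasDerivWithinAt)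
    (fun _ _ _ => lt_add_one K) ⟨hab, le_rfl⟩
  intro t ht r hr
  refine Eventually.frequently ?_
  filter_upwards [nhdsWithin_le_nhds (h t (Ico_subset_Icc_self ht)), self_mem_nhdsWithin]
    with τ hτ hlt
  have hpos : 0 < τ - t := sub_pos.2 hlt
  rw [slope_def_field, div_lt_iff₀ hpos]
  rw [abs_of_pos hpos] at hτ
  have h1 : |F τ - F a| - |F t - F a| ≤ |F τ - F t| := by
    have := abs_sub_abs_le_abs_sub (F τ - F a) (F t - F a)
    rwa [sub_sub_sub_cancel_right] at this
  have h2 : K * (τ - t) < r * (τ - t) := mul_lt_mul_of_pos_right hr hpos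
  simp only [Function.comp_apply, Real.norm_eq_abs]
  linarith

/-! ### The mean flux between a level line and the boundary -/

/-- The mean over the curve of the flux of the magnetic field through `(n, δ) × ℝ / Lℤ`. -/
noncomputable def meanFlux (b : Plane → ℝ) (γ : ℝ → Plane) (L δ n : ℝ) : ℝ :=
  1 / L * ∫ η in n..δ, ∫ ξ in (0 : ℝ)..L, tubularField b γ η ξ

section Flux

variable {Ω C : Set Plane} {γ : ℝ → Plane} {L δ : ℝ} {b : Plane → ℝ}

theorem continuousOn_integral_tubularField (h : IsArcLengthParam C γ L)
    (hδ : IsTubularWidth Ω C γ L δ) (hb : ContinuousOn b Ω) :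
    ContinuousOn (fun η => ∫ ξ in (0 : ℝ)..L, tubularField b γ η ξ) (Ioo 0 δ) := by
  rw [continuousOn_iff_continuous_domRestrict]
  refine intervalIntegral.continuous_parametric_intervalIntegral_of_continuous'
    (f := fun (η : Ioo 0 δ) ξ => tubularField b γ η ξ) ?_ 0 L
  have h1 : Continuous (fun x : Ioo 0 δ × ℝ => tubularMap γ ((x.1 : ℝ), x.2)) :=
    h.contDiff_tubularMap.continuous.comp (by fun_prop)
  have h2 : Continuous (fun x : Ioo 0 δ × ℝ => b (tubularMap γ ((x.1 : ℝ), x.2))) :=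
    hb.comp_continuous h1 fun x => hδ.tubularMap_mem h x.1.2 x.2
  have h3 := h.continuous_curvature
  exact h2.neg.mul (by fun_prop)

theorem hasDerivAt_meanFlux (h : IsArcLengthParam C γ L) (hδ : IsTubularWidth Ω C γ L δ)
    (hb : ContinuousOn b Ω)
    (hlim : Tendsto (fun n : ℝ => |∫ η in n..δ, ∫ ξ in (0 : ℝ)..L, tubularField b γ η ξ|)
      (𝓝[>] 0) atTop) {n : ℝ} (hn : n ∈ Ioo 0 δ) :
    HasDerivAt (meanFlux b γ L δ) (-(1 / L * ∫ ξ in (0 : ℝ)..L, tubularField b γ n ξ)) n := by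
  have hc := continuousOn_integral_tubularField h hδ hb
  -- Integrability up to `δ` is not assumed. The integral of a non-integrable function is `0` by
  -- convention, so a nonzero integral from some `m < n` forces integrability on `(m, δ)`, hence on
  -- `(n, δ)`.
  obtain ⟨m, hm, hm0, hmn⟩ := ((hlim.eventually_gt_atTop 0).and
    (Ioo_mem_nhdsGT hn.1 : ∀ᶠ m in 𝓝[>] (0 : ℝ), m ∈ Ioo 0 n)).exists
  have hint := intervalIntegral.intervalIntegrable_of_integral_ne_zero (abs_pos.1 hm)
  have hint' : IntervalIntegrable (fun η => ∫ ξ in (0 : ℝ)..L, tubularField b γ η ξ)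
      MeasureTheory.volume n δ := by
    refine hint.mono_set ?_
    rw [uIcc_of_le hn.2.le, uIcc_of_le (hmn.le.trans hn.2.le)]
    exact Icc_subset_Icc_left hmn.le
  have := (intervalIntegral.integral_hasDerivAt_left hint'
    (hc.stronglyMeasurableAtFilter isOpen_Ioo n hn)
    (hc.continuousAt (isOpen_Ioo.mem_nhds hn))).const_mul (1 / L)
  rwa [mul_neg] at this

/-- Along a motion in the collar, the mean flux minus the tangential momentum
`(1 - n κ(s)) ⟨v, γ'(s)⟩` is Lipschitz in time, although the curvature need not be
differentiable. -/
theorem eventually_abs_flux_sub_momentum_sub_le (h : IsArcLengthParam C γ L)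
    (hδ : IsTubularWidth Ω C γ L δ) (hb : ContinuousOn b Ω)
    (hlim : Tendsto (fun n : ℝ => |∫ η in n..δ, ∫ ξ in (0 : ℝ)..L, tubularField b γ η ξ|)
      (𝓝[>] 0) atTop) {M : ℝ} (hM0 : 0 ≤ M)
    (hM : ∀ n ∈ Ioo 0 δ, ∀ s : ℝ, |tubularField b γ n s
        - 1 / L * ∫ ξ in (0 : ℝ)..L, tubularField b γ n ξ| ≤ M)
    {k K c δ' : ℝ} (hk : ∀ s, |curvature γ s| ≤ k) (hK0 : 0 ≤ K)
    (hK : ∀ s s', |curvature γ s - curvature γ s'| ≤ K * |s - s'|)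
    (hδ' : δ' ≤ δ) (hkδ : δ' * k ≤ 1 / 2)
    {q v : ℝ → Plane} {n s : ℝ → ℝ} {t : ℝ} (hq : HasDerivAt q (v t) t)
    (hv : HasDerivAt v (-(b (q t)) • rot (v t)) t) (hvc : ∀ᶠ τ in 𝓝 t, ‖v τ‖ = c)
    (hns : ∀ᶠ τ in 𝓝 t, n τ ∈ Ioo 0 δ' ∧ tubularMap γ (n τ, s τ) = q τ) :
    ∀ᶠ τ in 𝓝 t,
      |(meanFlux b γ L δ (n τ) - (1 - n τ * curvature γ (s τ)) * inner ℝ (v τ) (deriv γ (s τ)))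
        - (meanFlux b γ L δ (n t) - (1 - n t * curvature γ (s t)) * inner ℝ (v t) (deriv γ (s t)))|
      ≤ ((M * c + k * c * c + 1) + ((c + 1) * k + δ * (K * (2 * c + 1))) * c) * |τ - t| := by
  obtain ⟨hnt, hqt⟩ := hns.self_of_nhds
  have hct := hvc.self_of_nhds
  have hc0 : 0 ≤ c := hct ▸ norm_nonneg _
  have hk0 : 0 ≤ k := (abs_nonneg _).trans (hk 0)
  have hnt' : n t ∈ Ioo 0 δ := ⟨hnt.1, hnt.2.trans_le hδ'⟩
  have hμ : 1 / 2 ≤ 1 - n t * curvature γ (s t) := by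
    have h1 : n t * curvature γ (s t) ≤ δ' * k :=
      (mul_le_mul_of_nonneg_left ((le_abs_self _).trans (hk (s t))) hnt.1.le).trans
        (mul_le_mul_of_nonneg_right hnt.2.le hk0)
    linarith
  have hμ0 : 1 - n t * curvature γ (s t) ≠ 0 := by linarith
  -- The given coordinates are not known to be continuous: `s` may jump by a period. They are
  -- replaced near `t` by a differentiable lift `(ν, σ)`, harmless because only `n`, `γ'(s)` and
  -- `κ(s)` enter the estimate.
  obtain ⟨ν, σ, hνt, hσt, hlift, hν, hσ⟩ := h.exists_tubular_lift hμ0 hq hqt.symm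
  have hνpos : ∀ᶠ τ in 𝓝 t, ν τ ∈ Ioo 0 δ :=
    hν.continuousAt.eventually (isOpen_Ioo.mem_nhds (by rw [hνt]; exact hnt'))
  have hinner : ∀ w : Plane, ‖w‖ = 1 → |inner ℝ (v t) w| ≤ c := fun w hw => by
    have := abs_real_inner_le_norm (v t) w
    rwa [hw, mul_one, hct] at this
  set a := inner ℝ (v t) (deriv γ (s t)) with ha
  set ν' := inner ℝ (v t) (normal γ (s t)) with hν'
  set κ := curvature γ (s t) with hκ
  set σ' := (1 - n t * κ)⁻¹ * a with hσ'
  have hac : |a| ≤ c := hinner _ (h.unit_speed _)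
  have hν'c : |ν'| ≤ c := hinner _ (by rw [norm_normal, h.unit_speed])
  have hσ'c : |σ'| ≤ 2 * c := by
    rw [hσ', abs_mul, abs_inv, abs_of_pos (by linarith : 0 < 1 - n t * κ)]
    have : (1 - n t * κ)⁻¹ ≤ 2 := by
      rw [inv_le_comm₀ (by linarith) two_pos]; linarith
    exact mul_le_mul this hac (abs_nonneg _) two_pos.le
  -- the momentum along the lifted curve
  have hg : HasDerivAt (fun τ => inner ℝ (v τ) (deriv γ (σ τ)))
      (b (q t) * ν' + κ * σ' * ν') t := by
    have hT : HasDerivAt (fun τ => deriv γ (σ τ)) (σ' • κ • normal γ (s t)) t := by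
      have h1 := h.hasDerivAt_deriv (s t)
      rw [← hσt] at h1
      have h2 := h1.scomp t hσ
      rw [hσt] at h2
      exact h2
    have h1 := hv.inner ℝ hT
    rw [hσt] at h1
    refine h1.congr_deriv ?_
    rw [inner_smul_right, inner_smul_right, inner_smul_left, inner_rot_left]
    simp only [conj_trivial]
    change σ' * (κ * ν') + -(b (q t)) * -ν' = _
    ring
  have hΦ : HasDerivAt (fun τ => meanFlux b γ L δ (ν τ))
      (-(1 / L * ∫ ξ in (0 : ℝ)..L, tubularField b γ (n t) ξ) * ν') t := by
    have h1 := hasDerivAt_meanFlux h hδ hb hlim hnt'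
    rw [← hνt] at h1
    have h2 := h1.comp t hν
    rw [hνt] at h2
    exact h2
  -- The factor `1 - n κ` is frozen at time `t`, since `κ ∘ σ` need not be differentiable; its
  -- variation is estimated separately in `hμev`.
  have hD := hΦ.sub (hg.const_mul (1 - n t * κ))
  have hB : tubularField b γ (n t) (s t) = -(b (q t)) * (1 - n t * κ) := by
    rw [tubularField, hqt]
  have hDbound : |-(1 / L * ∫ ξ in (0 : ℝ)..L, tubularField b γ (n t) ξ) * ν'
      - (1 - n t * κ) * (b (q t) * ν' + κ * σ' * ν')| < M * c + k * c * c + 1 := by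
    have hσa : (1 - n t * κ) * σ' = a := by rw [hσ', mul_inv_cancel_left₀ hμ0]
    -- The key cancellation: `(1 - n κ) b = -B` pairs the local field with its mean, and `(1 - n κ)
    -- σ' = a` removes the Jacobian.
    have h1 : -(1 / L * ∫ ξ in (0 : ℝ)..L, tubularField b γ (n t) ξ) * ν'
        - (1 - n t * κ) * (b (q t) * ν' + κ * σ' * ν')
        = (tubularField b γ (n t) (s t)
          - 1 / L * ∫ ξ in (0 : ℝ)..L, tubularField b γ (n t) ξ) * ν' - κ * a * ν' := by
      rw [hB, ← hσa]; ring
    rw [h1]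
    have h2 := abs_sub ((tubularField b γ (n t) (s t)
          - 1 / L * ∫ ξ in (0 : ℝ)..L, tubularField b γ (n t) ξ) * ν') (κ * a * ν')
    have h3 : |(tubularField b γ (n t) (s t)
          - 1 / L * ∫ ξ in (0 : ℝ)..L, tubularField b γ (n t) ξ) * ν'| ≤ M * c := by
      rw [abs_mul]
      exact mul_le_mul (hM _ hnt' _) hν'c (abs_nonneg _) hM0
    have h4 : |κ * a * ν'| ≤ k * c * c := by
      rw [abs_mul, abs_mul]
      exact mul_le_mul (mul_le_mul (hk _) hac (abs_nonneg _) hk0) hν'c (abs_nonneg _)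
        (by positivity)
    linarith
  have hDev := eventually_abs_sub_le_of_hasDerivAt hD hDbound
  have hνev := eventually_abs_sub_le_of_hasDerivAt hν (hν'c.trans_lt (lt_add_one c))
  have hσev := eventually_abs_sub_le_of_hasDerivAt hσ (hσ'c.trans_lt (lt_add_one (2 * c)))
  filter_upwards [hns, hvc, hlift, hνpos, hDev, hνev, hσev] with τ hnτ hcτ hlτ hντ h1 h2 h3
  obtain ⟨e1, e2, e3⟩ := hδ.eq_of_tubularMap_eq h ⟨hnτ.1.1, hnτ.1.2.trans_le hδ'⟩ hντ
    (hnτ.2.trans hlτ.symm)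
  rw [e1, e2, e3]
  simp only [Pi.sub_apply] at h1
  rw [hνt, hσt] at h1
  rw [hνt] at h2
  rw [hσt] at h3
  have hgτ : |inner ℝ (v τ) (deriv γ (σ τ))| ≤ c := by
    have := abs_real_inner_le_norm (v τ) (deriv γ (σ τ))
    rwa [h.unit_speed, mul_one, hcτ] at this
  have hμev : |ν τ * curvature γ (σ τ) - n t * κ|
      ≤ ((c + 1) * k + δ * (K * (2 * c + 1))) * |τ - t| := by
    have e : ν τ * curvature γ (σ τ) - n t * κ
        = (ν τ - n t) * curvature γ (σ τ) + n t * (curvature γ (σ τ) - κ) := by ring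
    rw [e]
    refine (abs_add_le _ _).trans ?_
    rw [abs_mul, abs_mul, abs_of_pos hnt.1]
    have h4 : |ν τ - n t| * |curvature γ (σ τ)| ≤ (c + 1) * |τ - t| * k :=
      mul_le_mul h2 (hk _) (abs_nonneg _) (by positivity)
    have h5 : |curvature γ (σ τ) - κ| ≤ K * ((2 * c + 1) * |τ - t|) :=
      (hK _ _).trans (mul_le_mul_of_nonneg_left h3 hK0)
    have h6 : n t * |curvature γ (σ τ) - κ| ≤ δ * (K * ((2 * c + 1) * |τ - t|)) :=
      mul_le_mul hnt'.2.le h5 (abs_nonneg _) hδ.pos.le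
    linarith
  -- The increment splits into that of the frozen quantity plus the variation of `n κ` times the
  -- bounded tangential velocity.
  have e : (meanFlux b γ L δ (ν τ)
        - (1 - ν τ * curvature γ (σ τ)) * inner ℝ (v τ) (deriv γ (σ τ)))
      - (meanFlux b γ L δ (n t) - (1 - n t * κ) * a)
      = (meanFlux b γ L δ (ν τ) - (1 - n t * κ) * inner ℝ (v τ) (deriv γ (σ τ))
          - (meanFlux b γ L δ (n t) - (1 - n t * κ) * a))
        + (ν τ * curvature γ (σ τ) - n t * κ) * inner ℝ (v τ) (deriv γ (σ τ)) := by ring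
  rw [e, add_mul _ _ |τ - t|]
  refine (abs_add_le _ _).trans (add_le_add h1 ?_)
  rw [abs_mul, mul_right_comm]
  exact mul_le_mul hμev hgτ (abs_nonneg _) (by have := hδ.pos; positivity)

/-- A motion does not converge to a point of a boundary curve in finite time. -/
theorem not_tendsto_boundary (h : IsArcLengthParam C γ L)
    (hδ : IsTubularWidth Ω C γ L δ) (hb : ContinuousOn b Ω)
    (hlim : Tendsto (fun n : ℝ => |∫ η in n..δ, ∫ ξ in (0 : ℝ)..L, tubularField b γ η ξ|)
      (𝓝[>] 0) atTop) {M : ℝ} (hM0 : 0 ≤ M)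
    (hM : ∀ n ∈ Ioo 0 δ, ∀ s : ℝ, |tubularField b γ n s
        - 1 / L * ∫ ξ in (0 : ℝ)..L, tubularField b γ n ξ| ≤ M)
    {T : ℝ} (hT : 0 < T) {z : ℝ → Plane × Plane}
    (hz : IsIntegralCurveIn (lorentzField b) (Ω ×ˢ univ) (Ico 0 T) z) {x : Plane} (hx : x ∈ C) :
    ¬ Tendsto (fun t => (z t).1) (𝓝[<] T) (𝓝 x) := by
  intro hlimx
  obtain ⟨k, hk0, hk⟩ := h.exists_abs_curvature_le
  obtain ⟨K, hK0, hK⟩ := h.exists_abs_curvature_sub_le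
  set c := ‖(z 0).2‖
  have hc0 : 0 ≤ c := norm_nonneg _
  -- close to time `T` the motion stays in thin collars
  have hdist : Tendsto (fun t => Metric.infDist (z t).1 C) (𝓝[<] T) (𝓝 0) := by
    have := ((Metric.continuous_infDist_pt C).tendsto x).comp hlimx
    rwa [Metric.infDist_zero_of_mem hx] at this
  have hcollar : ∀ ε > 0, ∀ᶠ t in 𝓝[<] T, (z t).1 ∈ collar Ω C ε := by
    intro ε hε
    filter_upwards [hdist.eventually_lt_const hε, Ioo_mem_nhdsLT hT] with t ht htT
    exact ⟨(hz t ⟨htT.1.le, htT.2⟩).1.1, ht⟩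
  -- This width gives `δ' k ≤ 1 / 2`, so `1 - n κ ≥ 1 / 2` in the collar; `k + 1` avoids dividing by
  -- zero.
  set δ' := min δ (1 / (2 * (k + 1))) with hδ'
  have hδ'0 : 0 < δ' := lt_min hδ.pos (by positivity)
  have hδ'δ : δ' ≤ δ := min_le_left _ _
  have hkδ : δ' * k ≤ 1 / 2 := by
    have h1 : δ' * (k + 1) ≤ 1 / (2 * (k + 1)) * (k + 1) :=
      mul_le_mul_of_nonneg_right (min_le_right _ _) (by linarith)
    have h2 : 1 / (2 * (k + 1)) * (k + 1) = 1 / 2 := by field_simp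
    nlinarith
  obtain ⟨t₀, ht₀T, ht₀⟩ := (mem_nhdsLT_iff_exists_Ioo_subset.1
    ((hcollar δ' hδ'0).and (Ioo_mem_nhdsLT hT)))
  have hcol : ∀ t ∈ Ioo t₀ T, ∃ y : ℝ × ℝ, y ∈ Ioo 0 δ' ×ˢ Ico 0 L ∧
      tubularMap γ y = (z t).1 := fun t ht => by
    obtain ⟨y, hy, hyt⟩ := (hδ.bijOn δ' ⟨hδ'0, hδ'δ⟩).surjOn (ht₀ ht).1
    exact ⟨y, hy, hyt⟩
  choose! y hy hyt using hcol
  have htpos : ∀ t ∈ Ioo t₀ T, t ∈ Ioo 0 T := fun t ht => (ht₀ ht).2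
  set F : ℝ → ℝ := fun t => meanFlux b γ L δ (y t).1
    - (1 - (y t).1 * curvature γ (y t).2) * inner ℝ (z t).2 (deriv γ (y t).2) with hF
  have hloc := fun t (ht : t ∈ Ioo t₀ T) =>
    eventually_abs_flux_sub_momentum_sub_le h hδ hb hlim hM0 hM hk hK0 hK hδ'δ hkδ
      (q := fun t => (z t).1) (v := fun t => (z t).2) (c := c)
      (n := fun t => (y t).1) (s := fun t => (y t).2)
      (((hz t (Ioo_subset_Ico_self (htpos t ht))).2.hasDerivAt
        (Ico_mem_nhds (htpos t ht).1 ht.2)).fst)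
      (((hz t (Ioo_subset_Ico_self (htpos t ht))).2.hasDerivAt
        (Ico_mem_nhds (htpos t ht).1 ht.2)).snd)
      (by
        filter_upwards [isOpen_Ioo.mem_nhds ht] with τ hτ
        exact norm_velocity_eq hz (Ioo_subset_Ico_self (htpos τ hτ)))
      (by
        filter_upwards [isOpen_Ioo.mem_nhds ht] with τ hτ
        exact ⟨(hy τ hτ).1, hyt τ hτ⟩)
  set Λ := (M * c + k * c * c + 1) + ((c + 1) * k + δ * (K * (2 * c + 1))) * c
  have hΛ0 : 0 ≤ Λ := by have := hδ.pos; positivity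
  obtain ⟨t₁, ht₁⟩ := exists_between (mem_Iio.1 ht₀T)
  have hFb : ∀ t ∈ Ico t₁ T, |F t - F t₁| ≤ (Λ + 1) * (T - t₁) := by
    intro t ht
    refine (abs_sub_le_of_eventually_abs_sub_le ht.1 fun τ hτ =>
      hloc τ ⟨ht₁.1.trans_le hτ.1, hτ.2.trans_lt ht.2⟩).trans ?_
    exact mul_le_mul_of_nonneg_left (by linarith [ht.2]) (by linarith)
  have hΦb : ∀ t ∈ Ico t₁ T, |meanFlux b γ L δ (y t).1| ≤ |F t₁| + (Λ + 1) * (T - t₁) + 2 * c := by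
    intro t ht
    have ht' : t ∈ Ioo t₀ T := ⟨ht₁.1.trans_le ht.1, ht.2⟩
    obtain ⟨⟨hn0, hnδ⟩, -⟩ := hy t ht'
    have h1 : |(1 - (y t).1 * curvature γ (y t).2) * inner ℝ (z t).2 (deriv γ (y t).2)|
        ≤ 2 * c := by
      rw [abs_mul]
      refine mul_le_mul ?_ ?_ (abs_nonneg _) two_pos.le
      · have h2 : |(y t).1 * curvature γ (y t).2| ≤ δ' * k := by
          rw [abs_mul, abs_of_pos hn0]
          exact mul_le_mul hnδ.le (hk _) (abs_nonneg _) hδ'0.le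
        have h3 := abs_sub 1 ((y t).1 * curvature γ (y t).2)
        rw [abs_one] at h3
        linarith
      · have := abs_real_inner_le_norm (z t).2 (deriv γ (y t).2)
        rwa [h.unit_speed, mul_one,
          norm_velocity_eq hz (Ioo_subset_Ico_self (htpos t ht'))] at this
    have h2 : meanFlux b γ L δ (y t).1 = (F t - F t₁) + F t₁
        + (1 - (y t).1 * curvature γ (y t).2) * inner ℝ (z t).2 (deriv γ (y t).2) := by
      simp only [hF]; ring
    rw [h2]
    have h3 := abs_add_le (F t - F t₁ + F t₁)
      ((1 - (y t).1 * curvature γ (y t).2) * inner ℝ (z t).2 (deriv γ (y t).2))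
    have h4 := abs_add_le (F t - F t₁) (F t₁)
    linarith [hFb t ht]
  -- the normal coordinate tends to zero, so that the flux is unbounded
  have hn : Tendsto (fun t => (y t).1) (𝓝[<] T) (𝓝[>] 0) := by
    refine tendsto_nhdsWithin_iff.2 ⟨?_, ?_⟩
    · refine Metric.tendsto_nhds.2 fun ε hε => ?_
      have hε' : 0 < min ε δ := lt_min hε hδ.pos
      filter_upwards [hcollar _ hε', Ioo_mem_nhdsLT ht₀T] with t ht htT
      -- A point of a thinner collar has tubular coordinates with small first entry; by uniqueness
      -- that entry is the `(y t).1` already chosen.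
      obtain ⟨w, hw, hwt⟩ := (hδ.bijOn _ ⟨hε', min_le_right _ _⟩).surjOn ht
      obtain ⟨⟨hn0, hnδ⟩, -⟩ := hy t htT
      have e := (hδ.eq_of_tubularMap_eq h (n := w.1) (s := w.2) (n' := (y t).1) (s' := (y t).2)
        ⟨hw.1.1, hw.1.2.trans_le (min_le_right _ _)⟩ ⟨hn0, hnδ.trans_le hδ'δ⟩
        (hwt.trans (hyt t htT).symm)).1
      rw [Real.dist_eq, sub_zero, abs_of_pos hn0, ← e]
      exact hw.1.2.trans_le (min_le_left _ _)
    · filter_upwards [Ioo_mem_nhdsLT ht₀T] with t htT using (hy t htT).1.1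
  have hinf := (hlim.comp hn).eventually_gt_atTop
    (L * (|F t₁| + (Λ + 1) * (T - t₁) + 2 * c))
  obtain ⟨t, ht, htT⟩ := (hinf.and (Ioo_mem_nhdsLT ht₁.2)).exists
  have hle := hΦb t (Ioo_subset_Ico_self htT)
  rw [meanFlux, abs_mul, abs_of_pos (one_div_pos.2 h.length_pos), one_div,
    inv_mul_le_iff₀ h.length_pos] at hle
  exact absurd ht (not_lt.2 hle)

end Flux

/-! ### Completeness -/

/-- If motions in a bounded open set do not converge to the boundary in finite time, then they can
be continued to `[0, ∞)`. -/
theorem exists_motion_Ici {Ω : Set Plane} (hΩ : IsOpen Ω) (hΩb : Bornology.IsBounded Ω)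
    {b : Plane → ℝ} (hb : LocallyLipschitzOn Ω b)
    (hno : ∀ T > 0, ∀ z : ℝ → Plane × Plane,
      IsIntegralCurveIn (lorentzField b) (Ω ×ˢ univ) (Ico 0 T) z →
      ∀ x ∈ frontier Ω, ¬ Tendsto (fun t => (z t).1) (𝓝[<] T) (𝓝 x))
    {q₀ : Plane} (hq₀ : q₀ ∈ Ω) (v₀ : Plane) :
    ∃ z : ℝ → Plane × Plane, z 0 = (q₀, v₀) ∧
      IsIntegralCurveIn (lorentzField b) (Ω ×ˢ univ) (Ici 0) z := by
  refine exists_isIntegralCurveIn_Ici (hΩ.prod isOpen_univ) (locallyLipschitzOn_lorentzField hb)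
    ⟨hq₀, mem_univ _⟩ fun T hT z hz0 hz => ?_
  have hIco : ∀ᶠ t in 𝓝[<] T, t ∈ Ico 0 T :=
    mem_of_superset (Ioo_mem_nhdsLT hT) Ioo_subset_Ico_self
  -- Constant speed makes the position Lipschitz, so it is Cauchy as `t → T`.
  have hlip : LipschitzOnWith ‖(z 0).2‖₊ (fun t => (z t).1) (Ico 0 T) :=
    (convex_Ico 0 T).lipschitzOnWith_of_nnnorm_hasDerivWithin_le
      (f' := fun t => (z t).2) (fun t ht => (hz t ht).2.fst) fun t ht => by
        rw [← NNReal.coe_le_coe, coe_nnnorm, coe_nnnorm]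
        exact (norm_velocity_eq hz ht).le
  obtain ⟨q₁, hq₁⟩ : ∃ q₁, Tendsto (fun t => (z t).1) (𝓝[<] T) (𝓝 q₁) :=
    CompleteSpace.complete ((cauchy_nhds.mono nhdsWithin_le_nhds).map_of_le
      hlip.uniformContinuousOn (le_principal_iff.2 hIco))
  have hcl : q₁ ∈ closure Ω := mem_closure_of_tendsto hq₁ (hIco.mono fun t ht => (hz t ht).1.1)
  have hq₁Ω : q₁ ∈ Ω := by
    by_contra hn
    exact hno T hT z hz q₁ (by rw [hΩ.frontier_eq]; exact ⟨hcl, hn⟩) hq₁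
  -- Convergence of the velocity is not needed: compactness gives a cluster point of position and
  -- velocity, whose position must be the limit `q₁`.
  obtain ⟨⟨q₂, v₂⟩, -, hy⟩ := (hΩb.isCompact_closure.prod
    (isCompact_closedBall (0 : Plane) ‖(z 0).2‖)).exists_mapClusterPt (u := z) (f := 𝓝[<] T)
    (by
      rw [le_principal_iff, mem_map]
      filter_upwards [hIco] with t ht
      refine ⟨subset_closure (hz t ht).1.1, ?_⟩
      rw [mem_closedBall_zero_iff]
      exact (norm_velocity_eq hz ht).le)
  have hq₂ : MapClusterPt q₂ (𝓝[<] T) (fun t => (z t).1) :=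
    hy.continuousAt_comp (f := Prod.fst) continuousAt_fst
  have heq : q₂ = q₁ := by
    have : NeBot (𝓝 q₂ ⊓ 𝓝 q₁) := NeBot.mono hq₂ (inf_le_inf_left _ hq₁)
    exact eq_of_nhds_neBot this
  exact ⟨(q₂, v₂), ⟨heq ▸ hq₁Ω, mem_univ _⟩, hy⟩

/-- A motion does not converge to a point of the boundary in finite time. -/
theorem not_tendsto_frontier {Ω : Set Plane} {b : Plane → ℝ} (hb : ContinuousOn b Ω)
    {γ : Set Plane → ℝ → Plane} {L δ : Set Plane → ℝ}
    (hγ : ∀ C, IsBoundaryComponent Ω C → IsArcLengthParam C (γ C) (L C))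
    (hδ : ∀ C, IsBoundaryComponent Ω C → IsTubularWidth Ω C (γ C) (L C) (δ C))
    (hlim : ∀ C, IsBoundaryComponent Ω C →
      Tendsto (fun n : ℝ => |∫ η in n..(δ C), ∫ ξ in (0 : ℝ)..(L C), tubularField b (γ C) η ξ|)
        (𝓝[>] 0) atTop)
    (hbdd : ∀ C, IsBoundaryComponent Ω C → ∃ M : ℝ, 0 ≤ M ∧ ∀ n ∈ Ioo 0 (δ C), ∀ s : ℝ,
      |tubularField b (γ C) n s
        - 1 / L C * ∫ ξ in (0 : ℝ)..(L C), tubularField b (γ C) n ξ| ≤ M)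
    (T : ℝ) (hT : 0 < T) (z : ℝ → Plane × Plane)
    (hz : IsIntegralCurveIn (lorentzField b) (Ω ×ˢ univ) (Ico 0 T) z)
    (x : Plane) (hx : x ∈ frontier Ω) : ¬ Tendsto (fun t => (z t).1) (𝓝[<] T) (𝓝 x) := by
  have hC : IsBoundaryComponent Ω (connectedComponentIn (frontier Ω) x) := ⟨x, hx, rfl⟩
  obtain ⟨M, hM0, hM⟩ := hbdd _ hC
  exact not_tendsto_boundary (hγ _ hC) (hδ _ hC) hb (hlim _ hC) hM0 hM hT hz
    (mem_connectedComponentIn hx)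

theorem tubularField_neg (b : Plane → ℝ) (γ : ℝ → Plane) (n s : ℝ) :
    tubularField (fun q => -b q) γ n s = -tubularField b γ n s := by
  simp only [tubularField]; ring

end MagneticConfinement

open MagneticConfinement in
theorem theorem2p1 (Ω : Set Plane) (hΩ : IsOpen Ω) (hΩb : Bornology.IsBounded Ω)
    (b : Plane → ℝ) (hb : LocallyLipschitzOn Ω b)
    (A : Plane → Plane) (hA : IsVectorPotential Ω A b)
    (γ : Set Plane → ℝ → Plane) (L δ : Set Plane → ℝ)
    (hγ : ∀ C, IsBoundaryComponent Ω C → IsArcLengthParam C (γ C) (L C))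
    (hδ : ∀ C, IsBoundaryComponent Ω C → IsTubularWidth Ω C (γ C) (L C) (δ C))
    (hlim : ∀ C, IsBoundaryComponent Ω C →
      Tendsto (fun n : ℝ => |∫ η in n..(δ C), ∫ ξ in (0 : ℝ)..(L C), tubularField b (γ C) η ξ|)
        (𝓝[>] 0) atTop)
    (hbdd : ∀ C, IsBoundaryComponent Ω C → ∃ M : ℝ, 0 ≤ M ∧ ∀ n ∈ Ioo 0 (δ C), ∀ s : ℝ,
      |tubularField b (γ C) n s
        - 1 / L C * ∫ ξ in (0 : ℝ)..(L C), tubularField b (γ C) n ξ| ≤ M) :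
    (∀ q₀ ∈ Ω, ∀ p₀ : Plane,
      ∃! z : ℝ → Plane × Plane, z 0 = (q₀, p₀) ∧ IsTrajectoryOn Ω A univ z) ∧
    (∀ T : ℝ, 0 < T → ∀ z : ℝ → Plane × Plane, IsTrajectoryOn Ω A (Ico 0 T) z →
      ∀ x ∈ frontier Ω, ¬ Tendsto (fun t => (z t).1) (𝓝[<] T) (𝓝 x)) := by
  have hno := not_tendsto_frontier hb.continuousOn hγ hδ hlim hbdd
  refine ⟨fun q₀ hq₀ p₀ => ?_, fun T hT z hz =>
    hno T hT (fun t => ((z t).1, (z t).2 - A (z t).1)) (hA.isIntegralCurveIn hΩ hz)⟩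
  -- Negative times are positive times for the field `-b` with opposite initial velocity; both flux
  -- hypotheses are unchanged under `b ↦ -b` thanks to the absolute values.
  have hb' : LocallyLipschitzOn Ω (fun q => -b q) := hb.neg
  have hno' := not_tendsto_frontier hb'.continuousOn hγ hδ
    (fun C hC => by
      simpa only [tubularField_neg, intervalIntegral.integral_neg, abs_neg] using hlim C hC)
    (fun C hC => by
      obtain ⟨M, hM0, hM⟩ := hbdd C hC
      refine ⟨M, hM0, fun n hn s => ?_⟩
      have := hM n hn s
      rw [← abs_neg] at this
      simp only [tubularField_neg, intervalIntegral.integral_neg]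
      convert this using 2
      ring)
  obtain ⟨α, hα0, hα⟩ := exists_motion_Ici hΩ hΩb hb hno hq₀ (p₀ - A q₀)
  obtain ⟨β, hβ0, hβ⟩ := exists_motion_Ici hΩ hΩb hb' hno' hq₀ (-(p₀ - A q₀))
  obtain ⟨z, hz0, hz⟩ := hα.exists_univ (isIntegralCurveIn_reverse hβ) (by simp [hα0, hβ0])
  have hf := locallyLipschitzOn_lorentzField hb
  refine ⟨_, ⟨?_, hA.isTrajectoryOn hΩ hz⟩, fun w hw => ?_⟩
  · simp [hz0, hα0]
  -- Uniqueness is proved in position and velocity, where the field is locally Lipschitz: Hamilton's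
  -- equations involve the derivative of `A`, which is only continuous.
  · have heq := (hA.isIntegralCurveIn hΩ hw.2).eq_of_univ hf hz (by simp [hw.1, hz0, hα0])
    funext t
    have ht := congrFun heq t
    rw [← ht]
    simp
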